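/- Let $P_m(z)\in\mathbb{C}[z]$, $m\ge 0$, be the sequence of polynomials generated by $$\sum_{m=0}^{\infty}P_m(z)\,t^m=\frac{1}{t^4z^2+t^3(-2z-36)+t^2(49-2z)-14t+1},$$ as an identity of formal power series in $t$ with coefficients in $\mathbb{C}[z]$. Then for every $m\ge 0$, every complex zero of $P_m(z)$ is real and lies in the open interval $(-\infty,-9/4)$. -/

import Mathlib

open Polynomial

/-- The denominator `t⁴z² + t³(-2z - 36) + t²(49 - 2z) - 14t + 1`, as a formal power series in `t`
(the variable `PowerSeries.X`) with coefficients in the polynomial ring `ℂ[z]`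
(the variable `Polynomial.X`). -/
noncomputable def queenDenom : PowerSeries ℂ[X] :=
  PowerSeries.X ^ 4 * PowerSeries.C ((X : ℂ[X]) ^ 2)
    + PowerSeries.X ^ 3 * PowerSeries.C (-2 * (X : ℂ[X]) - 36)
    + PowerSeries.X ^ 2 * PowerSeries.C (49 - 2 * (X : ℂ[X]))
    - 14 * PowerSeries.X + 1

/-- The constant term (in `t`) of the denominator is `1`. -/
theorem constantCoeff_queenDenom :
    PowerSeries.constantCoeff queenDenom = ((1 : ℂ[X]ˣ) : ℂ[X]) := by
  simp [queenDenom]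

/-- The polynomial `P_m(z)`: the coefficient of `t ^ m` in `1 / queenDenom`. -/
noncomputable def queenPoly (m : ℕ) : ℂ[X] :=
  PowerSeries.coeff m (PowerSeries.invOfUnit queenDenom 1)

/-- The generating function identity `(∑ P_m(z) t ^ m) * queenDenom = 1`; it determines the
sequence uniquely. -/
theorem queenPoly_generating (P : ℕ → ℂ[X]) :
    PowerSeries.mk P * queenDenom = 1 ↔ P = queenPoly := by
  have h1 : queenDenom * PowerSeries.invOfUnit queenDenom 1 = 1 :=
    PowerSeries.mul_invOfUnit queenDenom 1 constantCoeff_queenDenom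
  have h2 : PowerSeries.mk queenPoly = PowerSeries.invOfUnit queenDenom 1 := by
    ext1 n
    simp [queenPoly]
  constructor
  · intro h
    have h3 : PowerSeries.mk P = PowerSeries.invOfUnit queenDenom 1 := by
      calc PowerSeries.mk P
          = PowerSeries.mk P * (queenDenom * PowerSeries.invOfUnit queenDenom 1) := by
            rw [h1, mul_one]
        _ = PowerSeries.invOfUnit queenDenom 1 := by rw [← mul_assoc, h, one_mul]
    funext n
    rw [queenPoly, ← h3, PowerSeries.coeff_mk]
  · rintro rfl
    rw [h2, mul_comm, h1]

/-! Put z = u² - 3u. The denominator becomes F(u)F(3 - u), and F(3 - u) - F(u) = 2(2u - 3)t(1 -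
3t/2). Dividing by F(u)F(3 - u)(1 - 3t/2) shows that P_m(z) = 0 forces C(u) = C(3 - u), where C =
`cubicPoly (m + 1)`. All zeros of C have real part below 3/2, so, as in Hermite–Biehler, |C(u)| ≠
|C(3 - u)| off the line Re u = 3/2. On that line z ≤ -9/4, and positivity excludes equality. -/

open ComplexConjugate in
/-- A polynomial over `ℂ` with real coefficients whose zeros all have real part less than `c` is
larger in norm at a point to the right of the line `Re = c` than at the opposite point. -/
theorem norm_eval_two_mul_sub_lt {g : ℂ[X]} {c : ℝ} (hreal : ∀ u, g.eval (conj u) = conj (g.eval u))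
    (hdeg : g.natDegree ≠ 0) (hroots : ∀ r, g.eval r = 0 → r.re < c) {u : ℂ} (hu : c < u.re) :
    ‖g.eval (2 * c - u)‖ < ‖g.eval u‖ := by
  have hg : g ≠ 0 := by rintro rfl; simp at hdeg
  have hfac : ∀ x, ‖g.eval x‖ = ‖g.leadingCoeff‖ * (g.roots.map fun r => ‖x - r‖).prod := by
    intro x
    have hs := IsAlgClosed.splits g
    rw [hs.eval_eq_prod_roots, norm_mul]
    congr 1
    have := map_multiset_prod (normHom : ℂ →*₀ ℝ) (g.roots.map fun r => x - r)
    simpa [Multiset.map_map, Function.comp_def] using this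
  -- Conjugation turns the opposite point into the mirror image of `u` in the line, which is nearer
  -- to every root.
  have hconj : ‖g.eval (2 * c - u)‖ = ‖g.eval (2 * c - conj u)‖ := by
    have h := hreal (2 * c - u)
    rw [← Complex.norm_conj (g.eval (2 * c - u)), ← h]
    simp [Complex.conj_ofNat]
  rw [hconj, hfac, hfac]
  refine mul_lt_mul_of_pos_left ?_ (by simpa using hg)
  have hlt : ∀ r ∈ g.roots, ‖2 * c - conj u - r‖ < ‖u - r‖ := by
    intro r hr
    have hr' : r.re < c := hroots r (by simpa using (mem_roots hg).1 hr)
    rw [← sq_lt_sq₀ (norm_nonneg _) (norm_nonneg _), Complex.sq_norm, Complex.sq_norm,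
      Complex.normSq_apply, Complex.normSq_apply]
    simp
    nlinarith [mul_pos (sub_pos.2 hu) (sub_pos.2 hr')]
  have hne : g.roots ≠ 0 := by
    intro h
    have hc := (IsAlgClosed.splits g).natDegree_eq_card_roots
    rw [h] at hc
    exact hdeg (by simpa using hc)
  have hpos : ∀ r ∈ g.roots, 0 < ‖u - r‖ := fun r hr => (norm_nonneg _).trans_lt (hlt r hr)
  generalize g.roots = s at hlt hne hpos
  induction s using Multiset.induction_on with
  | empty => exact absurd rfl hne
  | cons a s ih =>
    simp only [Multiset.map_cons, Multiset.prod_cons]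
    have h1 := hlt a (Multiset.mem_cons_self a s)
    have hle : (s.map fun r => ‖2 * (c : ℂ) - conj u - r‖).prod
        ≤ (s.map fun r => ‖u - r‖).prod :=
      Multiset.prod_map_le_prod_map₀ _ _ (fun _ _ => norm_nonneg _)
        fun r hr => (hlt r (Multiset.mem_cons_of_mem hr)).le
    have hp : 0 < (s.map fun r => ‖u - r‖).prod := by
      refine Multiset.prod_pos fun x hx => ?_
      obtain ⟨r, hr, rfl⟩ := Multiset.mem_map.1 hx
      exact hpos r (Multiset.mem_cons_of_mem hr)
    exact mul_lt_mul_of_lt_of_le_of_nonneg_of_pos h1 hle (norm_nonneg _) hp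

/-! ### Auxiliary polynomials and their zeros -/

/-- The coefficients of `1 / ((1 - u t) ^ 2 - 4 t)`, as polynomials in `u`. -/
noncomputable def quadPoly : ℕ → ℂ[X]
  | 0 => 1
  | 1 => 2 * X + 4
  | n + 2 => (2 * X + 4) * quadPoly (n + 1) - X ^ 2 * quadPoly n

/-- The coefficients of `1 / ((1 - 3 t / 2) ((1 - u t) ^ 2 - 4 t))`, as polynomials in `u`. -/
noncomputable def cubicPoly : ℕ → ℂ[X]
  | 0 => 1
  | n + 1 => C (3 / 2) * cubicPoly n + quadPoly (n + 1)

theorem quadPoly_eval_conj (n : ℕ) (u : ℂ) :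
    (quadPoly n).eval (starRingEnd ℂ u) = starRingEnd ℂ ((quadPoly n).eval u) := by
  induction n using Nat.twoStepInduction with
  | zero => simp [quadPoly]
  | one => simp [quadPoly, Complex.conj_ofNat]
  | more n h0 h1 => simp [quadPoly, h0, h1, Complex.conj_ofNat]

theorem cubicPoly_eval_conj (n : ℕ) (u : ℂ) :
    (cubicPoly n).eval (starRingEnd ℂ u) = starRingEnd ℂ ((cubicPoly n).eval u) := by
  induction n with
  | zero => simp [cubicPoly]
  | succ n h => simp [cubicPoly, h, quadPoly_eval_conj, Complex.conj_ofNat]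

/-- The ratio obeys ρ ↦ 2 + 4/u - 1/ρ, and Re ρ ≥ 1 gives Re(1/ρ) ≤ 1, so the bound propagates. -/
theorem quadPoly_ratio {u : ℂ} (hu : 0 < u.re) (n : ℕ) : (quadPoly n).eval u ≠ 0 ∧
    1 + 4 * (u⁻¹).re ≤ ((quadPoly (n + 1)).eval u / (u * (quadPoly n).eval u)).re := by
  have hu0 : u ≠ 0 := by rintro rfl; simp at hu
  have hs : 0 < (u⁻¹).re := by
    rw [Complex.inv_re]
    exact div_pos hu (Complex.normSq_pos.2 hu0)
  induction n with
  | zero =>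
    have h : (quadPoly 1).eval u / (u * (quadPoly 0).eval u) = 2 + 4 * u⁻¹ := by
      simp [quadPoly]
      field_simp
    refine ⟨by simp [quadPoly], ?_⟩
    rw [h]
    simp
  | succ n ih =>
    obtain ⟨h0, h1⟩ := ih
    have hne : (quadPoly (n + 1)).eval u ≠ 0 := by
      intro h
      rw [h, zero_div, Complex.zero_re] at h1
      linarith
    refine ⟨hne, ?_⟩
    set ρ := (quadPoly (n + 1)).eval u / (u * (quadPoly n).eval u) with hρ
    have h : (quadPoly (n + 1 + 1)).eval u / (u * (quadPoly (n + 1)).eval u)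
        = 2 + 4 * u⁻¹ - ρ⁻¹ := by
      rw [hρ]
      simp [quadPoly]
      field_simp
    have hinv : (ρ⁻¹).re ≤ 1 := by
      rw [Complex.inv_re]
      refine div_le_one_of_le₀ ?_ (Complex.normSq_nonneg _)
      rw [Complex.normSq_apply]
      nlinarith [mul_self_nonneg ρ.im]
    rw [h]
    simp only [Complex.sub_re, Complex.add_re, Complex.mul_re, Complex.re_ofNat, Complex.im_ofNat]
    linarith

theorem quadPoly_norm_growth {u : ℂ} (hu : 3 / 2 ≤ u.re) (n : ℕ) :
    3 * ‖(quadPoly n).eval u‖ < ‖(quadPoly (n + 1)).eval u‖ := by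
  obtain ⟨h0, h1⟩ := quadPoly_ratio (by linarith : 0 < u.re) n
  have hu0 : u ≠ 0 := by rintro rfl; norm_num at hu
  have hr : 0 < ‖u‖ := norm_pos_iff.2 hu0
  have h2 := h1.trans (Complex.re_le_norm _)
  rw [norm_div, norm_mul, le_div_iff₀ (by positivity), Complex.inv_re, ← Complex.sq_norm] at h2
  refine lt_of_lt_of_le ?_ h2
  rw [← mul_assoc]
  refine mul_lt_mul_of_pos_right ?_ (norm_pos_iff.2 h0)
  have h3 : (1 + 4 * (u.re / ‖u‖ ^ 2)) * ‖u‖ = (‖u‖ ^ 2 + 4 * u.re) / ‖u‖ := by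
    field_simp
  rw [h3, lt_div_iff₀ hr]
  nlinarith [sq_nonneg (‖u‖ - 2)]

/-- The growth factor 3 is 2 · (3/2), exactly what the induction needs. -/
theorem cubicPoly_norm_le {u : ℂ} (hu : 3 / 2 ≤ u.re) (n : ℕ) :
    ‖(cubicPoly n).eval u‖ ≤ 2 * ‖(quadPoly n).eval u‖ := by
  induction n with
  | zero => simp [cubicPoly, quadPoly]
  | succ n ih =>
    have h := quadPoly_norm_growth hu n
    simp only [cubicPoly, eval_add, eval_mul, eval_C]
    refine (norm_add_le _ _).trans ?_
    rw [norm_mul, show ‖(3 / 2 : ℂ)‖ = 3 / 2 by norm_num]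
    linarith

/-- At a zero the recurrence gives |`quadPoly (n + 1)`| = (3/2)|`cubicPoly n`| ≤ 3|`quadPoly n`|,
against strict growth. -/
theorem cubicPoly_root_re_lt {n : ℕ} {u : ℂ} (h : (cubicPoly n).eval u = 0) : u.re < 3 / 2 := by
  by_contra! hu
  cases n with
  | zero => simp [cubicPoly] at h
  | succ n =>
    have hg := quadPoly_norm_growth hu n
    have hc := cubicPoly_norm_le hu n
    simp only [cubicPoly, eval_add, eval_mul, eval_C] at h
    rw [← neg_eq_iff_add_eq_zero] at h
    rw [← h, norm_neg, norm_mul, show ‖(3 / 2 : ℂ)‖ = 3 / 2 by norm_num] at hg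
    linarith

/-! ### Generating functions -/

theorem mk_quadPoly_mul (u : ℂ) :
    PowerSeries.mk (fun n => (quadPoly n).eval u)
      * (1 - PowerSeries.C (2 * u + 4) * PowerSeries.X
        + PowerSeries.C (u ^ 2) * PowerSeries.X ^ 2) = 1 := by
  have h : PowerSeries.mk (fun n => (quadPoly n).eval u)
      = 1 + PowerSeries.C (2 * u + 4) * PowerSeries.X
        * PowerSeries.mk (fun n => (quadPoly n).eval u)
        - PowerSeries.C (u ^ 2) * PowerSeries.X ^ 2
          * PowerSeries.mk (fun n => (quadPoly n).eval u) := by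
    ext n
    match n with
    | 0 => simp [quadPoly, mul_assoc]
    | 1 =>
      have h1 : ∀ f : PowerSeries ℂ,
          PowerSeries.coeff 1 (PowerSeries.X * f) = PowerSeries.coeff 0 f :=
        PowerSeries.coeff_succ_X_mul 0
      simp only [map_add (PowerSeries.coeff 1), map_sub (PowerSeries.coeff 1), quadPoly,
        mul_assoc, pow_two, PowerSeries.coeff_mk, PowerSeries.coeff_C_mul, h1,
        PowerSeries.coeff_one]
      simp
    | n + 2 =>
      simp only [map_add (PowerSeries.coeff (n + 2)), map_sub (PowerSeries.coeff (n + 2)),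
        quadPoly, mul_assoc, pow_two, PowerSeries.coeff_mk,
        PowerSeries.coeff_C_mul, PowerSeries.coeff_succ_X_mul, PowerSeries.coeff_one]
      simp
  linear_combination h

theorem mk_cubicPoly_mul (u : ℂ) :
    PowerSeries.mk (fun n => (cubicPoly n).eval u) * (1 - PowerSeries.C (3 / 2) * PowerSeries.X)
      = PowerSeries.mk (fun n => (quadPoly n).eval u) := by
  have h : PowerSeries.mk (fun n => (cubicPoly n).eval u)
      = PowerSeries.mk (fun n => (quadPoly n).eval u) + PowerSeries.C (3 / 2) * PowerSeries.X
        * PowerSeries.mk (fun n => (cubicPoly n).eval u) := by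
    ext n
    cases n with
    | zero => simp [quadPoly, cubicPoly, mul_assoc]
    | succ n => simp [cubicPoly, mul_assoc, PowerSeries.coeff_succ_X_mul, add_comm]
  linear_combination h

/-- With `z = u ^ 2 - 3 u` the denominator factors as `F u * F (3 - u)`, where
`F u = (1 - u t) ^ 2 - 4 t`. -/
theorem mk_queenPoly_eval (u : ℂ) :
    PowerSeries.mk (fun n => (queenPoly n).eval (u ^ 2 - 3 * u))
      = PowerSeries.mk (fun n => (quadPoly n).eval u)
        * PowerSeries.mk (fun n => (quadPoly n).eval (3 - u)) := by
  have hq := congrArg (PowerSeries.map (evalRingHom (u ^ 2 - 3 * u)))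
    ((queenPoly_generating queenPoly).2 rfl)
  have hmk : PowerSeries.map (evalRingHom (u ^ 2 - 3 * u)) (PowerSeries.mk queenPoly)
      = PowerSeries.mk (fun n => (queenPoly n).eval (u ^ 2 - 3 * u)) := by
    ext n
    simp
  have hD : PowerSeries.map (evalRingHom (u ^ 2 - 3 * u)) queenDenom
      = (1 - PowerSeries.C (2 * u + 4) * PowerSeries.X
          + PowerSeries.C (u ^ 2) * PowerSeries.X ^ 2)
        * (1 - PowerSeries.C (2 * (3 - u) + 4) * PowerSeries.X
          + PowerSeries.C ((3 - u) ^ 2) * PowerSeries.X ^ 2) := by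
    simp only [queenDenom, map_add, map_sub, map_mul, map_pow, PowerSeries.map_X,
      PowerSeries.map_C, map_one, map_ofNat, map_neg, coe_evalRingHom, eval_X]
    ring
  rw [map_mul, map_one, hmk, hD] at hq
  have h1 := mk_quadPoly_mul u
  have h2 := mk_quadPoly_mul (3 - u)
  generalize PowerSeries.mk (fun n => (queenPoly n).eval (u ^ 2 - 3 * u)) = P at *
  generalize PowerSeries.mk (fun n => (quadPoly n).eval u) = A at *
  generalize PowerSeries.mk (fun n => (quadPoly n).eval (3 - u)) = B at *
  generalize (1 - PowerSeries.C (2 * u + 4) * PowerSeries.X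
          + PowerSeries.C (u ^ 2) * PowerSeries.X ^ 2) = F at *
  generalize (1 - PowerSeries.C (2 * (3 - u) + 4) * PowerSeries.X
          + PowerSeries.C ((3 - u) ^ 2) * PowerSeries.X ^ 2) = F' at *
  linear_combination A * B * hq - P * (A * F) * h2 - P * h1

theorem cubicPoly_eval_sub_eval (u : ℂ) (m : ℕ) :
    (cubicPoly (m + 1)).eval u - (cubicPoly (m + 1)).eval (3 - u)
      = 2 * (2 * u - 3) * (queenPoly m).eval (u ^ 2 - 3 * u) := by
  have hP := mk_queenPoly_eval u
  have h1 := mk_quadPoly_mul u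
  have h2 := mk_quadPoly_mul (3 - u)
  have g1 := mk_cubicPoly_mul u
  have g2 := mk_cubicPoly_mul (3 - u)
  have key : PowerSeries.mk (fun n => (cubicPoly n).eval u)
      - PowerSeries.mk (fun n => (cubicPoly n).eval (3 - u))
      = PowerSeries.C (2 * (2 * u - 3)) * (PowerSeries.X
        * PowerSeries.mk (fun n => (queenPoly n).eval (u ^ 2 - 3 * u))) := by
    have hne : (1 - PowerSeries.C (3 / 2 : ℂ) * PowerSeries.X) ≠ 0 := by
      intro h
      simpa using congrArg PowerSeries.constantCoeff h
    refine mul_right_cancel₀ hne ?_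
    have hc : (2 : PowerSeries ℂ) * PowerSeries.C (3 / 2 : ℂ) = 3 := by
      rw [← map_ofNat (PowerSeries.C (R := ℂ)) 2, ← map_mul, ← map_ofNat (PowerSeries.C (R := ℂ)) 3]
      norm_num
    rw [sub_mul, g1, g2, hP]
    simp only [map_add, map_sub, map_mul, map_pow, map_ofNat] at h1 h2 ⊢
    generalize PowerSeries.mk (fun n => (quadPoly n).eval u) = A at *
    generalize PowerSeries.mk (fun n => (quadPoly n).eval (3 - u)) = B at *
    generalize PowerSeries.C (3 / 2 : ℂ) = c at *
    linear_combination B * h1 - A * h2 + A * B * PowerSeries.X ^ 2 * (2 * PowerSeries.C u - 3) * hc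
  have := congrArg (PowerSeries.coeff (m + 1)) key
  rwa [map_sub, PowerSeries.coeff_C_mul, PowerSeries.coeff_succ_X_mul, PowerSeries.coeff_mk,
    PowerSeries.coeff_mk, PowerSeries.coeff_mk] at this

theorem quadPoly_eval_three_halves (n : ℕ) : ∃ a : ℝ, 0 < a ∧ (quadPoly n).eval (3 / 2) = a := by
  suffices h : ∃ a b : ℝ, 0 < a ∧ a ≤ b ∧ (quadPoly n).eval (3 / 2) = a
      ∧ (quadPoly (n + 1)).eval (3 / 2) = b by
    obtain ⟨a, -, ha, -, h, -⟩ := h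
    exact ⟨a, ha, h⟩
  induction n with
  | zero => exact ⟨1, 7, by norm_num, by norm_num, by simp [quadPoly], by norm_num [quadPoly]⟩
  | succ n ih =>
    obtain ⟨a, b, ha, hab, h0, h1⟩ := ih
    refine ⟨b, 7 * b - 9 / 4 * a, by linarith, by linarith, h1, ?_⟩
    simp [quadPoly, h0, h1]
    ring

/-- Here u = 3 - u = 3/2, so the value is a self-convolution of positive numbers. -/
theorem queenPoly_eval_neg_nine_quarters_ne_zero (m : ℕ) : (queenPoly m).eval (-9 / 4) ≠ 0 := by
  choose a ha h using quadPoly_eval_three_halves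
  have hc := congrArg (PowerSeries.coeff m) (mk_queenPoly_eval (3 / 2))
  rw [PowerSeries.coeff_mul, PowerSeries.coeff_mk] at hc
  norm_num [h] at hc
  have hpos : 0 < ∑ x ∈ Finset.HasAntidiagonal.antidiagonal m, a x.1 * a x.2 :=
    Finset.sum_pos (fun x _ => mul_pos (ha _) (ha _)) ⟨(0, m), by simp⟩
  intro h0
  norm_num at h0
  rw [h0] at hc
  exact hpos.ne (by exact_mod_cast hc)

/-- Were it constant, the difference identity would make P_m vanish at -9/4. -/
theorem cubicPoly_succ_natDegree_ne_zero (m : ℕ) : (cubicPoly (m + 1)).natDegree ≠ 0 := by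
  intro h
  obtain ⟨c, hc⟩ := natDegree_eq_zero.1 h
  have hz : (2 * X - 3 : ℂ[X]) * (queenPoly m).comp (X ^ 2 - 3 * X) = 0 := by
    refine Polynomial.funext fun u => ?_
    have := cubicPoly_eval_sub_eval u m
    rw [← hc] at this
    simp only [eval_C, sub_self, mul_assoc] at this
    simpa using this.symm
  have hne : (2 * X - 3 : ℂ[X]) ≠ 0 := by
    intro h0
    have := congrArg (eval 0) h0
    norm_num at this
  have h0 := congrArg (eval (3 / 2)) ((mul_eq_zero.1 hz).resolve_left hne)
  apply queenPoly_eval_neg_nine_quarters_ne_zero m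
  rw [eval_comp] at h0
  norm_num at h0 ⊢
  exact h0

theorem re_eq_three_halves_of_queenPoly_eval_eq_zero {m : ℕ} {u : ℂ}
    (h : (queenPoly m).eval (u ^ 2 - 3 * u) = 0) : u.re = 3 / 2 := by
  have key : ∀ v : ℂ, (queenPoly m).eval (v ^ 2 - 3 * v) = 0 → v.re ≤ 3 / 2 := by
    intro v hv
    by_contra! hlt
    have hn := norm_eval_two_mul_sub_lt (c := 3 / 2) (cubicPoly_eval_conj (m + 1))
      (cubicPoly_succ_natDegree_ne_zero m) (fun r hr => cubicPoly_root_re_lt hr) hlt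
    have he := cubicPoly_eval_sub_eval v m
    rw [hv, mul_zero, sub_eq_zero] at he
    rw [he, show (2 * ((3 / 2 : ℝ) : ℂ) - v) = 3 - v by push_cast; ring] at hn
    exact lt_irrefl _ hn
  have h1 := key u h
  -- u and 3 - u give the same z, hence the reverse inequality.
  have h2 := key (3 - u) (by rw [← h]; congr 1; ring)
  simp at h2
  linarith

/-- Every complex zero of every `P_m` is a real number in the interval `(-∞, -9/4)`. -/
theorem theorem1 (m : ℕ) (z : ℂ) (hz : (queenPoly m).eval z = 0) :
    ∃ x : ℝ, x ∈ Set.Iio (-9 / 4 : ℝ) ∧ z = (x : ℂ) := by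
  obtain ⟨s, hs⟩ := IsAlgClosed.exists_pow_nat_eq (z + 9 / 4) (n := 2) (by norm_num)
  have hzu : z = (3 / 2 + s) ^ 2 - 3 * (3 / 2 + s) := by linear_combination -hs
  have hre : s.re = 0 := by
    have := re_eq_three_halves_of_queenPoly_eval_eq_zero (hzu ▸ hz)
    norm_num at this
    exact this
  have hsv : s = s.im * Complex.I := by
    apply Complex.ext <;> simp [hre]
  have hzx : z = ((-9 / 4 - s.im ^ 2 : ℝ) : ℂ) := by
    rw [hsv, mul_pow, Complex.I_sq] at hs
    push_cast
    linear_combination -hs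
  refine ⟨-9 / 4 - s.im ^ 2, ?_, hzx⟩
  have hv : s.im ≠ 0 := by
    intro h0
    apply queenPoly_eval_neg_nine_quarters_ne_zero m
    rw [h0] at hzx
    rw [← hz, hzx]
    norm_num
  have : 0 < s.im ^ 2 := by positivity
  simp only [Set.mem_Iio]
  linarith
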